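/- \textbf{Definitions.} A \emph{stochastic first-order oracle} on $\mathbb{R}^d$ consists of a probability distribution $\nu$ on a sample space $Z$ and a jointly measurable map $g:\mathbb{R}^d\times Z\to\mathbb{R}^d$; queried at $x$, it draws a fresh $z\sim\nu$ and returns $g(x,z)$. A (possibly randomized) \emph{first-order algorithm} on $\mathbb{R}^d$ draws a random seed $r$ once and chooses its $t$-th iterate as a measurable function $x_t=A_t(r,g_1,\dots,g_{t-1})$ of the seed and the earlier answers, where $g_s=g(x_s,z_s)$ and $z_1,z_2,\dots$ are i.i.d. with law $\nu$ and independent of $r$. It is \emph{zero-respecting} (on the given oracle) if almost surely $\mathrm{support}(x_t)\subseteq\bigcup_{s<t}\mathrm{support}(g_s)$ for all $t\ge 1$, where $\mathrm{support}(v)=\{i: v[i]\neq 0\}$. \textbf{Theorem.} For every $p\in(1,2]$ there is a constant $c>0$, depending only on $p$, such that for all $\Delta_1,L_0,\sigma_0>0$ there is an $\varepsilon_0>0$ such that for every $\varepsilon\in(0,\varepsilon_0]$ there exist a dimension $d$, a function $F:\mathbb{R}^d\to\mathbb{R}$ and a stochastic first-order oracle $(\nu,g)$ on $\mathbb{R}^d$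 with the following properties. \begin{itemize} \item $F$ is bounded below and $F(0)-\inf_{x\in\mathbb{R}^d}F(x)\le\Delta_1$. \item $F$ is differentiable and $\|\nabla F(x)-\nabla F(y)\|\le L_0\|x-y\|$ for all $x,y\in\mathbb{R}^d$ (Euclidean norm). \item For every $x\in\mathbb{R}^d$, $g(x,\cdot)$ is $\nu$-integrable, $\mathbb{E}_{z\sim\nu}[g(x,z)]=\nabla F(x)$ and $\mathbb{E}_{z\sim\nu}\big[\|g(x,z)-\nabla F(x)\|^{p}\big]\le\sigma_0^{p}$. \item For every zero-respecting first-order algorithm started at $x_1=0$ and run on this oracle, one has $\mathbb{E}\big[\|\nabla F(x_t)\|\big]>\varepsilon$ for every integer $t\ge 1$ with $$t\le c\,\Delta_1 L_0\,\sigma_0^{\frac{p}{p-1}}\,\varepsilon^{-\frac{3p-2}{p-1}}.$$ \end{itemize} That is, any such algorithm needs $\Omega\big(\Delta_1L_0\sigma_0^{p/(p-1)}\varepsilon^{-(3p-2)/(p-1)}\big)$ iterations to reach $\mathbb{E}\|\nabla F(x_t)\|\le\varepsilon$. -/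

import Mathlib

open MeasureTheory

universe u

/-- `ℝ^d` with the Euclidean norm. -/
abbrev Vec (d : ℕ) : Type := EuclideanSpace ℝ (Fin d)

/-- `F` is bounded below on `ℝ^d` and `F(0) - inf F ≤ Δ`. -/
def InitialGapAtMost {d : ℕ} (F : Vec d → ℝ) (Δ : ℝ) : Prop :=
  BddBelow (Set.range F) ∧ F 0 - ⨅ x, F x ≤ Δ

/-- `F` is differentiable and its gradient is `L`-Lipschitz for the Euclidean norm. -/
def IsSmoothFun {d : ℕ} (F : Vec d → ℝ) (L : ℝ) : Prop :=
  Differentiable ℝ F ∧ ∀ x y : Vec d, ‖gradient F x - gradient F y‖ ≤ L * ‖x - y‖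

/-- A stochastic first-order oracle on `ℝ^d`: queried at `x`, it draws a fresh sample `z` from the
probability distribution `law` and returns the single vector `grad x z`. -/
structure StochasticOracle (d : ℕ) where
  Sample : Type
  [mSample : MeasurableSpace Sample]
  law : Measure Sample
  [isProb : IsProbabilityMeasure law]
  grad : Vec d → Sample → Vec d
  measurable_grad : Measurable (Function.uncurry grad)

attribute [instance] StochasticOracle.mSample StochasticOracle.isProb

namespace StochasticOracle

variable {d : ℕ}

/-- At every query point the answer has a finite mean, equal to the gradient of `F`. -/
def IsUnbiased (O : StochasticOracle d) (F : Vec d → ℝ) : Prop :=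
  ∀ x, Integrable (O.grad x) O.law ∧ ∫ z, O.grad x z ∂O.law = gradient F x

/-- At every query point the `p`-th moment of the noise is at most `σ ^ p`. -/
def NoiseMomentAtMost (O : StochasticOracle d) (F : Vec d → ℝ) (p σ : ℝ) : Prop :=
  ∀ x, ∫⁻ z, ‖O.grad x z - gradient F x‖ₑ ^ p ∂O.law ≤ ENNReal.ofReal (σ ^ p)

end StochasticOracle

/-- A (possibly randomized) first-order algorithm on `ℝ^d`. It draws a seed `r` once, and its next
query after receiving the `t` answers `g 0, …, g (t - 1)` is `step t (r, g)`. -/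
structure FirstOrderAlgorithm (d : ℕ) where
  Seed : Type u
  [mSeed : MeasurableSpace Seed]
  seedLaw : Measure Seed
  [isProb : IsProbabilityMeasure seedLaw]
  step : (t : ℕ) → Seed × (Fin t → Vec d) → Vec d
  measurable_step : ∀ t, Measurable (step t)

attribute [instance] FirstOrderAlgorithm.mSeed FirstOrderAlgorithm.isProb

namespace FirstOrderAlgorithm

variable {d : ℕ}

/-- The outcomes of a run: the seed of the algorithm and one oracle sample for each iteration. -/
abbrev RunSpace (A : FirstOrderAlgorithm.{u} d) (O : StochasticOracle d) : Type u :=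
  A.Seed × (ℕ → O.Sample)

/-- The law of a run: the oracle samples are i.i.d. and independent of the seed. -/
noncomputable def runLaw (A : FirstOrderAlgorithm.{u} d) (O : StochasticOracle d) :
    Measure (A.RunSpace O) :=
  A.seedLaw.prod (Measure.infinitePi fun _ : ℕ => O.law)

/-- The first `t` answers that the algorithm receives in a run. -/
def answers (A : FirstOrderAlgorithm.{u} d) (O : StochasticOracle d) (ω : A.RunSpace O) :
    (t : ℕ) → Fin t → Vec d
  | 0 => Fin.elim0
  | t + 1 => Fin.snoc (α := fun _ => Vec d) (A.answers O ω t)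
      (O.grad (A.step t (ω.1, A.answers O ω t)) (ω.2 t))

/-- The iterates of a run, numbered from `0`: `A.iterate O t` is chosen after `t` answers, hence
is the `(t + 1)`-st iterate. -/
def iterate (A : FirstOrderAlgorithm.{u} d) (O : StochasticOracle d) (t : ℕ) (ω : A.RunSpace O) :
    Vec d :=
  A.step t (ω.1, A.answers O ω t)

/-- The answer of the oracle at the iterate with number `t`. -/
def answer (A : FirstOrderAlgorithm.{u} d) (O : StochasticOracle d) (t : ℕ) (ω : A.RunSpace O) :
    Vec d :=
  O.grad (A.iterate O t ω) (ω.2 t)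

/-- The algorithm starts at the point `x₁`. -/
def StartsAt (A : FirstOrderAlgorithm.{u} d) (O : StochasticOracle d) (x₁ : Vec d) : Prop :=
  ∀ᵐ ω ∂A.runLaw O, A.iterate O 0 ω = x₁

/-- The algorithm is zero-respecting when run on the oracle `O`: almost surely, the support of
every iterate is contained in the union of the supports of the earlier answers. -/
def IsZeroRespecting (A : FirstOrderAlgorithm.{u} d) (O : StochasticOracle d) : Prop :=
  ∀ᵐ ω ∂A.runLaw O, ∀ t : ℕ,
    Function.support (fun i => A.iterate O t ω i) ⊆
      ⋃ s < t, Function.support (fun i => A.answer O s ω i)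

/-- The expected gradient norm, with values in `[0, ∞]`, at the iterate with number `t`. -/
noncomputable def expectedGradNorm (A : FirstOrderAlgorithm.{u} d) (O : StochasticOracle d)
    (F : Vec d → ℝ) (t : ℕ) : ENNReal :=
  ∫⁻ ω, ‖gradient F (A.iterate O t ω)‖ₑ ∂A.runLaw O

end FirstOrderAlgorithm

/-! The hard function is a chain: the slope of each coordinate is gated by its predecessor, and a
constant coordinate 1 in front opens the first gate. While some coordinate is zero the gradient
stays large (`norm_chainGrad_ge`): the first coordinate of size below 1 has an open gate, and
`drift` keeps the coupling with the next coordinate from cancelling its slope. On the other hand, at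
a point supported on the first `n` coordinates the gradient reaches at most one coordinate further,
so an answer reveals at most one new coordinate.

The oracle multiplies that single revealing entry by `1 / q` with probability `q` and by 0
otherwise. This is unbiased, and since the entry is at most 1, the `p`-th moment of the noise is of
order `q ^ (1 - p)` before scaling. A zero-respecting run advances only on successes of the coin
(`support_iterate_lt`), so by Markov's inequality it needs order `d / q` queries to reach the last
coordinate with probability above 1/2.

At gradient scale `ε` and smoothness `L₀` each link uses order `ε ^ 2 / L₀` of the gap, which allows
`d` of order `Δ₁ L₀ / ε ^ 2`. The noise budget allows `q` of order `(ε / σ₀) ^ (p / (p - 1))`. The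
ratio `d / q` is the claimed rate, as `2 + p / (p - 1) = (3p - 2) / (p - 1)`. -/

/-! ### Scalar ingredients of the hard instance -/

namespace HardChain

/-- The gate: a smooth even function, flat at the origin, with values in `[0, 1]`. -/
noncomputable def gate (a : ℝ) : ℝ := a ^ 4 / (1 + a ^ 2) ^ 2

/-- The derivative of `gate`. -/
noncomputable def gateDeriv (a : ℝ) : ℝ := 4 * a ^ 3 / (1 + a ^ 2) ^ 3

/-- A bounded increasing function whose derivative dominates `2 * |gateDeriv|`. -/
noncomputable def drift (a : ℝ) : ℝ := 2 * Real.arctan a - 2 * a / (1 + a ^ 2)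

/-- The derivative of `drift`. -/
noncomputable def driftDeriv (a : ℝ) : ℝ := 4 * a ^ 2 / (1 + a ^ 2) ^ 2

theorem hasDerivAt_one_add_sq (a : ℝ) : HasDerivAt (fun a : ℝ => 1 + a ^ 2) (2 * a) a := by
  simpa using (hasDerivAt_pow 2 a).const_add 1

theorem hasDerivAt_gate (a : ℝ) : HasDerivAt gate (gateDeriv a) a := by
  have h : (1 + a ^ 2) ≠ 0 := by positivity
  have := (hasDerivAt_pow 4 a).div ((hasDerivAt_one_add_sq a).pow 2) (pow_ne_zero 2 h)
  refine this.congr_deriv ?_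
  simp only [gateDeriv, Pi.pow_apply]
  field_simp
  push_cast
  ring

theorem hasDerivAt_drift (a : ℝ) : HasDerivAt drift (driftDeriv a) a := by
  have h : (1 + a ^ 2) ≠ 0 := by positivity
  have := ((Real.hasDerivAt_arctan a).const_mul 2).sub
    (((hasDerivAt_id a).const_mul 2).div (hasDerivAt_one_add_sq a) h)
  refine this.congr_deriv ?_
  simp only [driftDeriv, id]
  field_simp
  ring

theorem hasDerivAt_gateDeriv (a : ℝ) :
    HasDerivAt gateDeriv (12 * a ^ 2 * (1 - a ^ 2) / (1 + a ^ 2) ^ 4) a := by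
  have h : (1 + a ^ 2) ≠ 0 := by positivity
  have := ((hasDerivAt_pow 3 a).const_mul 4).div ((hasDerivAt_one_add_sq a).pow 3)
    (pow_ne_zero 3 h)
  refine this.congr_deriv ?_
  simp only [Pi.pow_apply]
  field_simp
  push_cast
  ring

theorem hasDerivAt_driftDeriv (a : ℝ) :
    HasDerivAt driftDeriv (8 * a * (1 - a ^ 2) / (1 + a ^ 2) ^ 3) a := by
  have h : (1 + a ^ 2) ≠ 0 := by positivity
  have := ((hasDerivAt_pow 2 a).const_mul 4).div ((hasDerivAt_one_add_sq a).pow 2)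
    (pow_ne_zero 2 h)
  refine this.congr_deriv ?_
  simp only [Pi.pow_apply]
  field_simp
  push_cast
  ring

theorem hasDerivAt_inv_one_add_sq (a : ℝ) :
    HasDerivAt (fun a : ℝ => 1 / (1 + a ^ 2)) (-(2 * a) / (1 + a ^ 2) ^ 2) a := by
  have h : (1 + a ^ 2) ≠ 0 := by positivity
  simpa only [one_div] using (hasDerivAt_one_add_sq a).fun_inv h

theorem abs_div_one_add_sq_le (a : ℝ) : |a| / (1 + a ^ 2) ≤ 1 / 2 := by
  rw [div_le_div_iff₀ (by positivity) (by norm_num)]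
  nlinarith [sq_nonneg (|a| - 1), sq_abs a]

theorem inv_one_add_sq_le_one (a : ℝ) : 1 / (1 + a ^ 2) ≤ 1 := by
  rw [div_le_one (by positivity)]
  nlinarith [sq_nonneg a]

theorem sq_div_one_add_sq_le_one (a : ℝ) : a ^ 2 / (1 + a ^ 2) ≤ 1 := by
  rw [div_le_one (by positivity)]
  linarith

theorem abs_one_sub_sq_div_le_one (a : ℝ) : |1 - a ^ 2| / (1 + a ^ 2) ≤ 1 := by
  rw [div_le_one (by positivity), abs_le]
  constructor <;> nlinarith [sq_nonneg a]

theorem gate_nonneg (a : ℝ) : 0 ≤ gate a := by unfold gate; positivity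

theorem gate_le_one (a : ℝ) : gate a ≤ 1 := by
  have h : gate a = (a ^ 2 / (1 + a ^ 2)) ^ 2 := by unfold gate; rw [div_pow]; ring
  rw [h]
  exact pow_le_one₀ (by positivity) (sq_div_one_add_sq_le_one a)

theorem gate_zero : gate 0 = 0 := by simp [gate]

theorem gateDeriv_zero : gateDeriv 0 = 0 := by simp [gateDeriv]

theorem driftDeriv_zero : driftDeriv 0 = 0 := by simp [driftDeriv]

theorem drift_zero : drift 0 = 0 := by simp [drift]

theorem driftDeriv_nonneg (a : ℝ) : 0 ≤ driftDeriv a := by unfold driftDeriv; positivity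

theorem quarter_le_gate {a : ℝ} (ha : 1 ≤ |a|) : 1 / 4 ≤ gate a := by
  have h1 : 1 ≤ a ^ 2 := by rw [← sq_abs]; nlinarith
  unfold gate
  rw [div_le_div_iff₀ (by norm_num) (by positivity)]
  nlinarith [sq_nonneg a]

/-- The factor 2 is the bound used for `|arctan|`: this is what lets the drift absorb the coupling
term in `slope`. -/
theorem two_mul_abs_gateDeriv_le (a : ℝ) : 2 * |gateDeriv a| ≤ driftDeriv a := by
  have h : 2 * |gateDeriv a| = 2 * (|a| / (1 + a ^ 2)) * driftDeriv a := by
    have h0 : (0 : ℝ) < 1 + a ^ 2 := by positivity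
    unfold gateDeriv driftDeriv
    rw [abs_div, abs_mul, abs_pow, abs_of_pos (by positivity : (0 : ℝ) < (1 + a ^ 2) ^ 3),
      abs_of_pos (by norm_num : (0 : ℝ) < 4), pow_succ |a| 2, sq_abs]
    field_simp
  rw [h]
  nlinarith [abs_div_one_add_sq_le a, driftDeriv_nonneg a]

theorem driftDeriv_le_one (a : ℝ) : driftDeriv a ≤ 1 := by
  have h : driftDeriv a = 4 * (|a| / (1 + a ^ 2)) ^ 2 := by
    unfold driftDeriv; rw [div_pow, sq_abs]; ring
  have h0 : 0 ≤ |a| / (1 + a ^ 2) := by positivity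
  rw [h]
  nlinarith [abs_div_one_add_sq_le a]

theorem abs_gateDeriv_le (a : ℝ) : |gateDeriv a| ≤ 1 / 2 := by
  linarith [two_mul_abs_gateDeriv_le a, driftDeriv_le_one a]

theorem abs_arctan_le_two (a : ℝ) : |Real.arctan a| ≤ 2 := by
  rw [abs_le]
  constructor <;>
    linarith [Real.neg_pi_div_two_lt_arctan a, Real.arctan_lt_pi_div_two a, Real.pi_lt_four]

theorem abs_sub_le_of_hasDerivAt {f f' : ℝ → ℝ} {C : ℝ} (hf : ∀ x, HasDerivAt f (f' x) x)
    (hC : ∀ x, |f' x| ≤ C) (x y : ℝ) : |f x - f y| ≤ C * |x - y| := by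
  have := convex_univ.norm_image_sub_le_of_norm_hasDerivWithin_le (f := f) (f' := f') (C := C)
    (fun x _ => (hf x).hasDerivWithinAt) (fun x _ => hC x) (Set.mem_univ y) (Set.mem_univ x)
  simpa using this

theorem gate_lipschitz (x y : ℝ) : |gate x - gate y| ≤ 1 / 2 * |x - y| :=
  abs_sub_le_of_hasDerivAt hasDerivAt_gate abs_gateDeriv_le x y

theorem arctan_lipschitz (x y : ℝ) : |Real.arctan x - Real.arctan y| ≤ 1 * |x - y| := by
  refine abs_sub_le_of_hasDerivAt Real.hasDerivAt_arctan (fun x => ?_) x y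
  rw [abs_of_nonneg (by positivity)]
  exact inv_one_add_sq_le_one x

theorem inv_one_add_sq_lipschitz (x y : ℝ) :
    |1 / (1 + x ^ 2) - 1 / (1 + y ^ 2)| ≤ 1 * |x - y| := by
  refine abs_sub_le_of_hasDerivAt hasDerivAt_inv_one_add_sq (fun a => ?_) x y
  have h : |-(2 * a) / (1 + a ^ 2) ^ 2| = 2 * (|a| / (1 + a ^ 2)) * (1 / (1 + a ^ 2)) := by
    rw [abs_div, abs_neg, abs_mul, abs_of_pos (by positivity : (0 : ℝ) < (1 + a ^ 2) ^ 2),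
      abs_of_pos (by norm_num : (0 : ℝ) < 2)]
    field_simp
  have h1 : 0 ≤ 1 / (1 + a ^ 2) := by positivity
  have h2 : 0 ≤ |a| / (1 + a ^ 2) := by positivity
  rw [h]
  nlinarith [abs_div_one_add_sq_le a, inv_one_add_sq_le_one a]

theorem gateDeriv_lipschitz (x y : ℝ) : |gateDeriv x - gateDeriv y| ≤ 3 * |x - y| := by
  refine abs_sub_le_of_hasDerivAt hasDerivAt_gateDeriv (fun a => ?_) x y
  have h : |12 * a ^ 2 * (1 - a ^ 2) / (1 + a ^ 2) ^ 4|
      = 3 * driftDeriv a * (|1 - a ^ 2| / (1 + a ^ 2)) * (1 / (1 + a ^ 2)) := by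
    rw [abs_div, abs_mul, abs_of_pos (by positivity : (0 : ℝ) < (1 + a ^ 2) ^ 4),
      abs_of_nonneg (by positivity : (0 : ℝ) ≤ 12 * a ^ 2)]
    unfold driftDeriv
    field_simp
    ring
  rw [h]
  calc 3 * driftDeriv a * (|1 - a ^ 2| / (1 + a ^ 2)) * (1 / (1 + a ^ 2))
      ≤ 3 * 1 * 1 * 1 := by
        have := driftDeriv_nonneg a
        gcongr
        · exact driftDeriv_le_one a
        · exact abs_one_sub_sq_div_le_one a
        · exact inv_one_add_sq_le_one a
    _ = 3 := by norm_num

theorem driftDeriv_lipschitz (x y : ℝ) : |driftDeriv x - driftDeriv y| ≤ 4 * |x - y| := by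
  refine abs_sub_le_of_hasDerivAt hasDerivAt_driftDeriv (fun a => ?_) x y
  have h : |8 * a * (1 - a ^ 2) / (1 + a ^ 2) ^ 3|
      = 8 * (|a| / (1 + a ^ 2)) * (|1 - a ^ 2| / (1 + a ^ 2)) * (1 / (1 + a ^ 2)) := by
    rw [abs_div, abs_mul, abs_mul, abs_of_pos (by positivity : (0 : ℝ) < (1 + a ^ 2) ^ 3),
      abs_of_pos (by norm_num : (0 : ℝ) < 8)]
    field_simp
  rw [h]
  calc 8 * (|a| / (1 + a ^ 2)) * (|1 - a ^ 2| / (1 + a ^ 2)) * (1 / (1 + a ^ 2))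
      ≤ 8 * (1 / 2) * 1 * 1 := by
        exact mul_le_mul (mul_le_mul (mul_le_mul_of_nonneg_left (abs_div_one_add_sq_le a)
          (by norm_num)) (abs_one_sub_sq_div_le_one a) (by positivity) (by norm_num))
          (inv_one_add_sq_le_one a) (by positivity) (by norm_num)
    _ = 4 := by norm_num

theorem abs_drift_le (a : ℝ) : |drift a| ≤ 4.15 := by
  have h : |2 * a / (1 + a ^ 2)| ≤ 1 := by
    rw [abs_div, abs_mul, abs_of_pos (by norm_num : (0 : ℝ) < 2),
      abs_of_pos (by positivity : (0 : ℝ) < 1 + a ^ 2), mul_div_assoc]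
    linarith [abs_div_one_add_sq_le a]
  have h2 : |2 * Real.arctan a| ≤ 3.15 := by
    rw [abs_le]
    constructor <;>
      linarith [Real.neg_pi_div_two_lt_arctan a, Real.arctan_lt_pi_div_two a, Real.pi_lt_d2]
  unfold drift
  linarith [abs_sub (2 * Real.arctan a) (2 * a / (1 + a ^ 2))]

/-! ### The chain function -/

variable {d : ℕ}

/-- The coordinates of `x`, shifted by one, preceded by `1` and followed by zeros. -/
def pad (x : Vec d) : ℕ → ℝ
  | 0 => 1
  | n + 1 => if h : n < d then x ⟨n, h⟩ else 0

@[simp] theorem pad_zero (x : Vec d) : pad x 0 = 1 := rfl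

@[simp] theorem pad_succ_val (x : Vec d) (i : Fin d) : pad x (i + 1) = x i := by simp [pad]

theorem pad_succ_of_le (x : Vec d) {n : ℕ} (h : d ≤ n) : pad x (n + 1) = 0 := by
  simp [pad, h]

/-- The linear part of `pad`. -/
noncomputable def padLin (d : ℕ) : ℕ → Vec d →L[ℝ] ℝ
  | 0 => 0
  | n + 1 => if h : n < d then EuclideanSpace.proj ⟨n, h⟩ else 0

theorem hasFDerivAt_pad (x : Vec d) : ∀ n, HasFDerivAt (fun x => pad x n) (padLin d n) x
  | 0 => hasFDerivAt_const _ _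
  | n + 1 => by
    by_cases h : n < d
    · simp only [pad, padLin, h, dite_true]
      exact (EuclideanSpace.proj (𝕜 := ℝ) (⟨n, h⟩ : Fin d)).hasFDerivAt
    · simp only [pad, padLin, h, dite_false]
      exact hasFDerivAt_const _ _

theorem padLin_succ_val (v : Vec d) (i : Fin d) : padLin d (i + 1) v = v i := by simp [padLin]

/-- The chain function: the slope of a coordinate is gated by the preceding one. -/
noncomputable def chain (x : Vec d) : ℝ :=
  -∑ n ∈ Finset.range d,
    (gate (pad x n) * Real.arctan (pad x (n + 1)) + drift (pad x (n + 1)))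

/-- Minus the `n`-th partial derivative of `chain`. -/
noncomputable def slope (x : Vec d) (n : ℕ) : ℝ :=
  gate (pad x n) * (1 / (1 + pad x (n + 1) ^ 2))
    + gateDeriv (pad x (n + 1)) * Real.arctan (pad x (n + 2)) + driftDeriv (pad x (n + 1))

/-- The gradient of `chain`. -/
noncomputable def chainGrad (x : Vec d) : Vec d := WithLp.toLp 2 fun i : Fin d => -slope x i

theorem chainGrad_apply (x : Vec d) (i : Fin d) : chainGrad x i = -slope x i := rfl

theorem hasGradientAt_chain (x : Vec d) : HasGradientAt chain (chainGrad x) x := by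
  rw [hasGradientAt_iff_hasFDerivAt]
  have hterm : ∀ n ∈ Finset.range d, HasFDerivAt
      (fun x => gate (pad x n) * Real.arctan (pad x (n + 1)) + drift (pad x (n + 1)))
      (gate (pad x n) • (1 / (1 + pad x (n + 1) ^ 2)) • padLin d (n + 1)
        + Real.arctan (pad x (n + 1)) • gateDeriv (pad x n) • padLin d n
        + driftDeriv (pad x (n + 1)) • padLin d (n + 1)) x := by
    intro n _
    have h1 : HasFDerivAt (fun x => gate (pad x n)) (gateDeriv (pad x n) • padLin d n) x :=
      HasDerivAt.comp_hasFDerivAt (f := fun x => pad x n) x (hasDerivAt_gate (pad x n))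
        (hasFDerivAt_pad x n)
    have h2 : HasFDerivAt (fun x => Real.arctan (pad x (n + 1)))
        ((1 / (1 + pad x (n + 1) ^ 2)) • padLin d (n + 1)) x :=
      HasDerivAt.comp_hasFDerivAt (f := fun x => pad x (n + 1)) x (Real.hasDerivAt_arctan (pad x (n + 1)))
        (hasFDerivAt_pad x (n + 1))
    have h3 : HasFDerivAt (fun x => drift (pad x (n + 1)))
        (driftDeriv (pad x (n + 1)) • padLin d (n + 1)) x :=
      HasDerivAt.comp_hasFDerivAt (f := fun x => pad x (n + 1)) x (hasDerivAt_drift (pad x (n + 1)))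
        (hasFDerivAt_pad x (n + 1))
    exact (h1.mul h2).add h3
  refine (HasFDerivAt.fun_sum hterm).neg.congr_fderiv ?_
  ext v
  have hinner : inner ℝ (chainGrad x) v
      = -∑ n ∈ Finset.range d, slope x n * padLin d (n + 1) v := by
    rw [Finset.sum_range]
    simp only [PiLp.inner_apply, chainGrad_apply, padLin_succ_val, ← Finset.sum_neg_distrib]
    exact Finset.sum_congr rfl fun i _ => by simp [mul_comm]
  -- Coordinate `n` also occurs as the gate of the next summand; reindexing collects both
  -- contributions. The boundary terms drop out: `padLin d 0 = 0` at the start, `arctan 0 = 0` past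
  -- the end.
  have hshift : ∑ n ∈ Finset.range d, gateDeriv (pad x n) * Real.arctan (pad x (n + 1))
        * padLin d n v
      = ∑ n ∈ Finset.range d, gateDeriv (pad x (n + 1)) * Real.arctan (pad x (n + 2))
        * padLin d (n + 1) v := by
    have h1 := Finset.sum_range_succ (fun n => gateDeriv (pad x n) * Real.arctan (pad x (n + 1))
      * padLin d n v) d
    rw [Finset.sum_range_succ'] at h1
    simp only [pad_succ_of_le x le_rfl, Real.arctan_zero, mul_zero, zero_mul, add_zero] at h1
    rw [← h1]
    simp [padLin]
  rw [InnerProductSpace.toDual_apply_apply, hinner]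
  simp only [neg_apply, sum_apply, add_apply, smul_apply, smul_eq_mul, neg_inj, slope, add_mul, Finset.sum_add_distrib]
  rw [← hshift]
  simp only [← Finset.sum_add_distrib]
  exact Finset.sum_congr rfl fun n _ => by ring

theorem chain_zero : chain (0 : Vec d) = 0 := by
  have h : ∀ n, pad (0 : Vec d) (n + 1) = 0 := fun n => by simp [pad]
  simp [chain, h, drift_zero]

theorem neg_le_chain (x : Vec d) : -(6 * d : ℝ) ≤ chain x := by
  have h : ∀ n ∈ Finset.range d,
      gate (pad x n) * Real.arctan (pad x (n + 1)) + drift (pad x (n + 1)) ≤ 6 := fun n _ => by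
    have h1 := (abs_le.1 (abs_drift_le (pad x (n + 1)))).2
    have h2 : Real.arctan (pad x (n + 1)) ≤ 1.6 := by
      linarith [Real.arctan_lt_pi_div_two (pad x (n + 1)), Real.pi_lt_d2]
    nlinarith [gate_nonneg (pad x n), gate_le_one (pad x n)]
  have := Finset.sum_le_card_nsmul _ _ _ h
  simp only [Finset.card_range, nsmul_eq_mul] at this
  unfold chain
  linarith

theorem abs_mul_sub_mul_le {a b a' b' A B : ℝ} (ha : |a| ≤ A) (hb : |b'| ≤ B) :
    |a * b - a' * b'| ≤ A * |b - b'| + B * |a - a'| := by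
  have h : a * b - a' * b' = a * (b - b') + b' * (a - a') := by ring
  rw [h]
  refine (abs_add_le _ _).trans ?_
  rw [abs_mul, abs_mul]
  gcongr

theorem abs_slope_sub_le (x y : Vec d) (n : ℕ) :
    |slope x n - slope y n| ≤ 11 * (|pad x n - pad y n| + |pad x (n + 1) - pad y (n + 1)|
      + |pad x (n + 2) - pad y (n + 2)|) := by
  have h1 := abs_mul_sub_mul_le (a := gate (pad x n)) (b := 1 / (1 + pad x (n + 1) ^ 2))
    (a' := gate (pad y n)) (b' := 1 / (1 + pad y (n + 1) ^ 2)) (A := 1) (B := 1)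
    (by rw [abs_of_nonneg (gate_nonneg _)]; exact gate_le_one _)
    (by rw [abs_of_nonneg (by positivity)]; exact inv_one_add_sq_le_one _)
  have h2 := abs_mul_sub_mul_le (b := Real.arctan (pad x (n + 2)))
    (a' := gateDeriv (pad y (n + 1))) (abs_gateDeriv_le (pad x (n + 1)))
    (abs_arctan_le_two (pad y (n + 2)))
  have h3 := driftDeriv_lipschitz (pad x (n + 1)) (pad y (n + 1))
  have h4 := gate_lipschitz (pad x n) (pad y n)
  have h5 := inv_one_add_sq_lipschitz (pad x (n + 1)) (pad y (n + 1))
  have h6 := gateDeriv_lipschitz (pad x (n + 1)) (pad y (n + 1))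
  have h7 := arctan_lipschitz (pad x (n + 2)) (pad y (n + 2))
  have h8 : ∀ a b c a' b' c' : ℝ, |a + b + c - (a' + b' + c')| ≤ |a - a'| + |b - b'| + |c - c'| :=
    fun a b c a' b' c' => by
      rw [show a + b + c - (a' + b' + c') = (a - a') + (b - b') + (c - c') by ring]
      exact abs_add_three _ _ _
  -- The middle coordinate has the worst coefficient: 1 + 2 * 3 + 4 = 11; its two neighbours get 1/2
  -- each.
  refine (h8 _ _ _ _ _ _).trans ?_
  linarith [abs_nonneg (pad x n - pad y n), abs_nonneg (pad x (n + 1) - pad y (n + 1)),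
    abs_nonneg (pad x (n + 2) - pad y (n + 2))]

/-- Each partial derivative sees only three consecutive coordinates, so the constant is independent
of `d`. By `(a + b + c) ^ 2 ≤ 3 (a ^ 2 + b ^ 2 + c ^ 2)` and three shifted sums, it is the root of 3
* 121 * 3 = 33 ^ 2. -/
theorem norm_chainGrad_sub_le (x y : Vec d) : ‖chainGrad x - chainGrad y‖ ≤ 33 * ‖x - y‖ := by
  set e : ℕ → ℝ := fun n => (pad x n - pad y n) ^ 2 with he
  have hsum : ∑ n ∈ Finset.range d, e (n + 1) = ‖x - y‖ ^ 2 := by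
    rw [Finset.sum_range, EuclideanSpace.norm_sq_eq]
    exact Finset.sum_congr rfl fun i _ => by simp [he]
  have he0 : e 0 = 0 := by simp [he]
  have hed : ∀ n, d ≤ n → e (n + 1) = 0 := fun n hn => by simp [he, pad_succ_of_le _ hn]
  have hnn : ∀ n, 0 ≤ e n := fun n => sq_nonneg _
  have hprev : ∑ n ∈ Finset.range d, e n ≤ ‖x - y‖ ^ 2 := by
    have h := Finset.sum_range_succ e d
    rw [Finset.sum_range_succ', hsum] at h
    linarith [hnn d]
  have hnext : ∑ n ∈ Finset.range d, e (n + 2) ≤ ‖x - y‖ ^ 2 := by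
    have h := Finset.sum_range_succ (fun n => e (n + 1)) d
    rw [Finset.sum_range_succ', hsum, hed d le_rfl] at h
    linarith [hnn 1]
  refine le_of_sq_le_sq ?_ (by positivity)
  calc ‖chainGrad x - chainGrad y‖ ^ 2
      = ∑ n ∈ Finset.range d, (slope x n - slope y n) ^ 2 := by
        rw [Finset.sum_range, EuclideanSpace.norm_sq_eq]
        refine Finset.sum_congr rfl fun i _ => ?_
        rw [PiLp.sub_apply, chainGrad_apply, chainGrad_apply, Real.norm_eq_abs, sq_abs]
        ring
    _ ≤ ∑ n ∈ Finset.range d, 363 * (e n + e (n + 1) + e (n + 2)) := by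
        refine Finset.sum_le_sum fun n _ => ?_
        rw [← sq_abs]
        refine (pow_le_pow_left₀ (abs_nonneg _) (abs_slope_sub_le x y n) 2).trans ?_
        simp only [he, ← sq_abs (pad x _ - pad y _)]
        nlinarith [sq_nonneg (|pad x n - pad y n| - |pad x (n + 1) - pad y (n + 1)|),
          sq_nonneg (|pad x n - pad y n| - |pad x (n + 2) - pad y (n + 2)|),
          sq_nonneg (|pad x (n + 1) - pad y (n + 1)| - |pad x (n + 2) - pad y (n + 2)|)]
    _ ≤ (33 * ‖x - y‖) ^ 2 := by
        rw [← Finset.mul_sum, Finset.sum_add_distrib, Finset.sum_add_distrib, hsum]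
        nlinarith

/-- Whatever the sign of the next coordinate, the drift pays for the coupling term, leaving the
gated slope as a lower bound. -/
theorem gate_mul_le_slope (x : Vec d) (n : ℕ) :
    gate (pad x n) * (1 / (1 + pad x (n + 1) ^ 2)) ≤ slope x n := by
  have h : |gateDeriv (pad x (n + 1)) * Real.arctan (pad x (n + 2))|
      ≤ driftDeriv (pad x (n + 1)) := by
    rw [abs_mul]
    have := two_mul_abs_gateDeriv_le (pad x (n + 1))
    nlinarith [abs_arctan_le_two (pad x (n + 2)), abs_nonneg (gateDeriv (pad x (n + 1)))]
  unfold slope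
  linarith [neg_abs_le (gateDeriv (pad x (n + 1)) * Real.arctan (pad x (n + 2)))]

theorem norm_chainGrad_ge (x : Vec d) (i : Fin d) (hi : x i = 0) : 1 / 8 ≤ ‖chainGrad x‖ := by
  classical
  -- The zero coordinate only guarantees that a coordinate of size below 1 exists. The first such
  -- one has a predecessor of size at least 1, hence slope at least 1/4 * 1/2.
  have hex : ∃ n, n < d ∧ |pad x (n + 1)| < 1 := ⟨i, i.2, by simp [hi]⟩
  obtain ⟨hn, hlt⟩ := Nat.find_spec hex
  have hmin := fun m => Nat.find_min hex (m := m)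
  set n := Nat.find hex
  have hprev : 1 ≤ |pad x n| := by
    rcases Nat.eq_zero_or_pos n with h0 | h0
    · simp [h0]
    · obtain ⟨m, hm⟩ := Nat.exists_eq_succ_of_ne_zero h0.ne'
      have := hmin m (by omega)
      rw [hm]
      by_contra hc
      exact this ⟨by omega, not_le.1 hc⟩
  have hden : 1 / 2 ≤ 1 / (1 + pad x (n + 1) ^ 2) := by
    have : pad x (n + 1) ^ 2 ≤ 1 := by
      rw [← sq_abs]; nlinarith [abs_nonneg (pad x (n + 1))]
    exact one_div_le_one_div_of_le (by positivity) (by linarith)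
  have hs : 1 / 8 ≤ slope x n := by
    refine le_trans ?_ (gate_mul_le_slope x n)
    nlinarith [quarter_le_gate hprev]
  calc 1 / 8 ≤ slope x n := hs
    _ ≤ ‖chainGrad x ⟨n, hn⟩‖ := by
      rw [chainGrad_apply, norm_neg]; exact le_abs_self _
    _ ≤ ‖chainGrad x‖ := PiLp.norm_apply_le _ _

/-! ### The frontier of the chain -/

/-- The coordinate `i` and all later ones vanish. -/
def ZeroFrom (x : Vec d) (i : Fin d) : Prop := ∀ j, i ≤ j → x j = 0

theorem ZeroFrom.slope_eq {x : Vec d} {i : Fin d} (h : ZeroFrom x i) :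
    slope x i = gate (pad x i) := by
  simp [slope, h i le_rfl, gateDeriv_zero, driftDeriv_zero]

/-- Beyond the start of the zero block the predecessor is zero too, so the gate is shut. -/
theorem ZeroFrom.slope_eq_zero {x : Vec d} {i j : Fin d} (h : ZeroFrom x i) (hij : i < j) :
    slope x j = 0 := by
  have hj : ZeroFrom x j := fun k hk => h k (hij.le.trans hk)
  obtain ⟨m, hm⟩ := Nat.exists_eq_succ_of_ne_zero (by have : i.val < j.val := hij; omega : j.val ≠ 0)
  have hmd : m < d := by omega
  have : pad x j = x ⟨m, hmd⟩ := by rw [hm]; exact pad_succ_val x ⟨m, hmd⟩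
  rw [hj.slope_eq, this, h ⟨m, hmd⟩ (by have : i.val < j.val := hij; show i.val ≤ m; omega), gate_zero]

open Classical in
/-- The part of the gradient of `chain` on the coordinates that start a block of zeros reaching
to the end. It has at most one nonzero entry. -/
noncomputable def frontierGrad (x : Vec d) : Vec d :=
  WithLp.toLp 2 fun i : Fin d => if ZeroFrom x i then chainGrad x i else 0

open Classical in
theorem frontierGrad_apply (x : Vec d) (i : Fin d) :
    frontierGrad x i = if ZeroFrom x i then chainGrad x i else 0 := rfl

/-- Of two nonzero entries the later would have a shut gate, so there is at most one, and it is a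
value of `gate` up to sign. The noise is thus bounded independently of `d`. -/
theorem norm_frontierGrad_le_one (x : Vec d) : ‖frontierGrad x‖ ≤ 1 := by
  classical
  by_cases hex : ∃ i, frontierGrad x i ≠ 0
  · obtain ⟨i, hi⟩ := hex
    have hZ : ZeroFrom x i := by
      by_contra h; exact hi (by simp [frontierGrad_apply, h])
    have hne : ∀ {j : Fin d}, frontierGrad x j ≠ 0 → ZeroFrom x j ∧ slope x j ≠ 0 := by
      intro j hj
      rw [frontierGrad_apply] at hj
      split_ifs at hj with h
      · exact ⟨h, by simpa [chainGrad_apply] using hj⟩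
      · exact absurd rfl hj
    have huniq : ∀ j, j ≠ i → frontierGrad x j = 0 := by
      intro j hji
      by_contra hj
      rcases lt_or_gt_of_ne hji with h | h
      · exact (hne hi).2 ((hne hj).1.slope_eq_zero h)
      · exact (hne hj).2 ((hne hi).1.slope_eq_zero h)
    refine le_of_sq_le_sq ?_ zero_le_one
    rw [EuclideanSpace.norm_sq_eq, Finset.sum_eq_single i
      (fun j _ hj => by simp [huniq j hj]) (by simp), frontierGrad_apply, if_pos hZ,
      chainGrad_apply, hZ.slope_eq, norm_neg, Real.norm_of_nonneg (gate_nonneg _), one_pow]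
    exact pow_le_one₀ (gate_nonneg _) (gate_le_one _)
  · push Not at hex
    have : frontierGrad x = 0 := by ext i; simpa using hex i
    simp [this]

/-- If `x` is supported on the first `n` coordinates, then a nonzero entry of a rescaling of the
frontier part lies among the first `n`, or is the next one and then the scaling is nonzero. -/
theorem lt_of_chainGrad_add_ne_zero {x : Vec d} {n : ℕ} (hx : ∀ i, x i ≠ 0 → i.val < n)
    {θ : ℝ} {i : Fin d} (hi : (chainGrad x + (θ - 1) • frontierGrad x) i ≠ 0) :
    i.val < n ∨ i.val = n ∧ θ ≠ 0 := by
  classical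
  rcases lt_trichotomy i.val n with h | h | h
  · exact Or.inl h
  · refine Or.inr ⟨h, fun hθ => hi ?_⟩
    have hZ : ZeroFrom x i := fun j hj => by
      by_contra hc
      have := hx j hc
      have : i.val ≤ j.val := hj
      omega
    simp [frontierGrad_apply, hZ, hθ]
  · exfalso
    have hn : n < d := by omega
    have hZ : ZeroFrom x ⟨n, hn⟩ := fun j hj => by
      by_contra hc
      have := hx j hc
      have : n ≤ j.val := hj
      omega
    have h0 : chainGrad x i = 0 := by
      rw [chainGrad_apply, hZ.slope_eq_zero (by show n < i.val; exact h), neg_zero]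
    exact hi (by simp [frontierGrad_apply, h0])

theorem measurable_chainGrad : Measurable (chainGrad : Vec d → Vec d) := by
  refine LipschitzWith.continuous (K := 33) ?_ |>.measurable
  exact LipschitzWith.of_dist_le_mul fun x y => by
    simpa [dist_eq_norm] using norm_chainGrad_sub_le x y

/-- The frontier jumps as coordinates become zero; this is harmless, since the oracle need only be
measurable in the query point. -/
theorem measurable_frontierGrad : Measurable (frontierGrad : Vec d → Vec d) := by
  classical
  refine (WithLp.measurable_toLp 2 _).comp (measurable_pi_lambda _ fun i => ?_)
  refine Measurable.ite ?_ ?_ measurable_const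
  · have : {x : Vec d | ZeroFrom x i} = ⋂ j, ⋂ (_ : i ≤ j), {x : Vec d | x j = 0} := by
      ext; simp [ZeroFrom]
    rw [this]
    refine MeasurableSet.iInter fun j => MeasurableSet.iInter fun _ => ?_
    exact (EuclideanSpace.proj (𝕜 := ℝ) j).continuous.measurable (measurableSet_singleton 0)
  · exact (EuclideanSpace.proj (𝕜 := ℝ) i).continuous.measurable.comp measurable_chainGrad

/-! ### The rescaled chain function -/

/-- The chain function with values scaled by `a` and arguments scaled by `l`. -/
noncomputable def scaledChain (d : ℕ) (a l : ℝ) (x : Vec d) : ℝ := a * chain (l⁻¹ • x)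

theorem hasGradientAt_scaledChain (a l : ℝ) (x : Vec d) :
    HasGradientAt (scaledChain d a l) ((a / l) • chainGrad (l⁻¹ • x)) x := by
  rw [hasGradientAt_iff_hasFDerivAt]
  have h1 : HasFDerivAt (fun x : Vec d => l⁻¹ • x) (l⁻¹ • ContinuousLinearMap.id ℝ (Vec d)) x :=
    (hasFDerivAt_id x).const_smul l⁻¹
  have h2 := (((hasGradientAt_iff_hasFDerivAt.1
    (hasGradientAt_chain (l⁻¹ • x))).comp x h1).const_mul a)
  refine h2.congr_fderiv ?_
  ext v
  simp
  ring

theorem gradient_scaledChain (a l : ℝ) (x : Vec d) :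
    gradient (scaledChain d a l) x = (a / l) • chainGrad (l⁻¹ • x) :=
  (hasGradientAt_scaledChain a l x).gradient

theorem initialGapAtMost_scaledChain {a l Δ : ℝ} (ha : 0 ≤ a) (hΔ : a * (6 * d) ≤ Δ) :
    InitialGapAtMost (scaledChain d a l) Δ := by
  have hlow : ∀ x : Vec d, -Δ ≤ scaledChain d a l x := fun x => by
    have := mul_le_mul_of_nonneg_left (neg_le_chain (l⁻¹ • x)) ha
    unfold scaledChain
    linarith
  refine ⟨⟨-Δ, by rintro _ ⟨x, rfl⟩; exact hlow x⟩, ?_⟩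
  have h0 : scaledChain d a l 0 = 0 := by simp [scaledChain, chain_zero]
  linarith [le_ciInf hlow]

theorem isSmoothFun_scaledChain {a l L : ℝ} (ha : 0 ≤ a) (hl : 0 < l) (hL : 33 * a ≤ L * l ^ 2) :
    IsSmoothFun (scaledChain d a l) L := by
  refine ⟨fun x => (hasGradientAt_scaledChain a l x).differentiableAt, fun x y => ?_⟩
  rw [gradient_scaledChain, gradient_scaledChain, ← smul_sub, norm_smul,
    Real.norm_of_nonneg (by positivity)]
  calc a / l * ‖chainGrad (l⁻¹ • x) - chainGrad (l⁻¹ • y)‖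
      ≤ a / l * (33 * ‖l⁻¹ • x - l⁻¹ • y‖) := by gcongr; exact norm_chainGrad_sub_le _ _
    _ = 33 * a / l ^ 2 * ‖x - y‖ := by
        rw [← smul_sub, norm_smul, Real.norm_of_nonneg (by positivity)]
        field_simp
    _ ≤ L * ‖x - y‖ := by
        gcongr
        rwa [div_le_iff₀ (by positivity)]

/-! ### The oracle -/

/-- The law on `Bool` of a success with probability `q`. -/
noncomputable def coin (q : ℝ) : Measure Bool :=
  ENNReal.ofReal q • Measure.dirac true + ENNReal.ofReal (1 - q) • Measure.dirac false

theorem isProbabilityMeasure_coin {q : ℝ} (h0 : 0 ≤ q) (h1 : q ≤ 1) :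
    IsProbabilityMeasure (coin q) := by
  constructor
  simp [coin, ← ENNReal.ofReal_add h0 (sub_nonneg.2 h1)]

/-- The scaling factor of the frontier: `1 / q` after a success and `0` otherwise. -/
noncomputable def reveal (q : ℝ) (z : Bool) : ℝ := if z then 1 / q else 0

/-- The oracle that shows the frontier of the gradient of `scaledChain` with probability `q`. -/
noncomputable def chainOracle (d : ℕ) (b l q : ℝ) (h0 : 0 ≤ q) (h1 : q ≤ 1) :
    StochasticOracle d where
  Sample := Bool
  law := coin q
  isProb := isProbabilityMeasure_coin h0 h1
  grad x z := b • (chainGrad (l⁻¹ • x) + (reveal q z - 1) • frontierGrad (l⁻¹ • x))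
  measurable_grad := by
    refine measurable_from_prod_countable_left fun z => ?_
    have h : Measurable fun x : Vec d => l⁻¹ • x := measurable_const_smul _
    exact ((measurable_chainGrad.comp h).add
      ((measurable_frontierGrad.comp h).const_smul (reveal q z - 1))).const_smul b

theorem isUnbiased_chainOracle {a l q : ℝ} (h0 : 0 < q) (h1 : q ≤ 1) :
    (chainOracle d (a / l) l q h0.le h1).IsUnbiased (scaledChain d a l) := by
  intro x
  have := isProbabilityMeasure_coin h0.le h1
  have hint : ∀ f : Bool → Vec d, Integrable f (coin q) := fun f => Integrable.of_finite
  refine ⟨hint _, ?_⟩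
  rw [gradient_scaledChain]
  show ∫ z, (a / l) • (chainGrad (l⁻¹ • x) + (reveal q z - 1) • frontierGrad (l⁻¹ • x)) ∂coin q = _
  have hmean : ∫ z, (reveal q z - 1) ∂coin q = 0 := by
    unfold coin
    rw [integral_add_measure
      ((Integrable.of_finite (μ := .dirac true)).smul_measure ENNReal.ofReal_ne_top)
      ((Integrable.of_finite (μ := .dirac false)).smul_measure ENNReal.ofReal_ne_top),
      integral_smul_measure, integral_smul_measure, integral_dirac, integral_dirac,
      ENNReal.toReal_ofReal h0.le, ENNReal.toReal_ofReal (sub_nonneg.2 h1)]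
    simp [reveal]
    field_simp
    ring
  rw [integral_smul, integral_add (hint _) (hint _), integral_smul_const, hmean, integral_const, probReal_univ, one_smul,
    zero_smul, add_zero]

/-- A success contributes at most `q * q ^ (-p)`, a failure at most `1 ≤ q ^ (1 - p)`, both times
`(a / l) ^ p`; hence the factor 2. -/
theorem noiseMomentAtMost_chainOracle {a l q p σ : ℝ} (h0 : 0 < q) (h1 : q ≤ 1) (hp : 1 < p)
    (ha : 0 ≤ a) (hl : 0 < l) (hq : 2 * (a / l) ^ p * q ^ (1 - p) ≤ σ ^ p) :
    (chainOracle d (a / l) l q h0.le h1).NoiseMomentAtMost (scaledChain d a l) p σ := by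
  intro x
  have hp0 : 0 ≤ p := by linarith
  have hb : 0 ≤ a / l := by positivity
  have hpt : ∀ z, ‖(chainOracle d (a / l) l q h0.le h1).grad x z
      - gradient (scaledChain d a l) x‖ₑ ^ p
        ≤ ENNReal.ofReal ((a / l) ^ p * |reveal q z - 1| ^ p) := by
    intro z
    have he : (chainOracle d (a / l) l q h0.le h1).grad x z - gradient (scaledChain d a l) x
        = ((a / l) * (reveal q z - 1)) • frontierGrad (l⁻¹ • x) := by
      rw [gradient_scaledChain, mul_smul]
      simp [chainOracle]
    rw [he, ← ofReal_norm, ENNReal.ofReal_rpow_of_nonneg (norm_nonneg _) hp0,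
      ← Real.mul_rpow hb (abs_nonneg _)]
    refine ENNReal.ofReal_le_ofReal (Real.rpow_le_rpow (norm_nonneg _) ?_ hp0)
    rw [norm_smul, Real.norm_eq_abs, abs_mul, abs_of_nonneg hb]
    exact mul_le_of_le_one_right (by positivity) (norm_frontierGrad_le_one _)
  refine (lintegral_mono hpt).trans ?_
  show ∫⁻ z, ENNReal.ofReal ((a / l) ^ p * |reveal q z - 1| ^ p) ∂coin q ≤ _
  have htrue : |reveal q true - 1| ^ p ≤ q ^ (-p) := by
    have h2 : 1 ≤ 1 / q := by rw [le_div_iff₀ h0]; linarith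
    rw [Real.rpow_neg h0.le, ← Real.inv_rpow h0.le]
    refine Real.rpow_le_rpow (abs_nonneg _) ?_ hp0
    simp only [reveal, if_true]
    rw [abs_of_nonneg (by linarith), one_div]
    linarith
  have hfalse : |reveal q false - 1| ^ p = 1 := by simp [reveal]
  unfold coin
  rw [lintegral_add_measure, lintegral_smul_measure, lintegral_smul_measure, lintegral_dirac,
    lintegral_dirac, hfalse, smul_eq_mul, smul_eq_mul, ← ENNReal.ofReal_mul h0.le,
    ← ENNReal.ofReal_mul (sub_nonneg.2 h1),
    ← ENNReal.ofReal_add (by positivity) (mul_nonneg (sub_nonneg.2 h1) (by positivity))]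
  refine ENNReal.ofReal_le_ofReal (le_trans ?_ hq)
  have hone : 1 ≤ q ^ (1 - p) := Real.one_le_rpow_of_pos_of_le_one_of_nonpos h0 h1 (by linarith)
  have hqq : q * q ^ (-p) = q ^ (1 - p) := by
    rw [sub_eq_add_neg, Real.rpow_add h0, Real.rpow_one]
  calc q * ((a / l) ^ p * |reveal q true - 1| ^ p) + (1 - q) * ((a / l) ^ p * 1)
      ≤ q * ((a / l) ^ p * q ^ (-p)) + 1 * ((a / l) ^ p * q ^ (1 - p)) := by
        gcongr
        linarith
    _ = 2 * (a / l) ^ p * q ^ (1 - p) := by rw [← hqq]; ring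

/-! ### Progress of a zero-respecting algorithm -/

/-- The number of successes among the first `t` samples. -/
def successes (z : ℕ → Bool) (t : ℕ) : ℕ := ∑ s ∈ Finset.range t, if z s then 1 else 0

theorem successes_succ (z : ℕ → Bool) (t : ℕ) :
    successes z (t + 1) = successes z t + if z t then 1 else 0 := Finset.sum_range_succ _ _

theorem successes_mono (z : ℕ → Bool) : Monotone (successes z) :=
  monotone_nat_of_le_succ fun t => by rw [successes_succ]; exact Nat.le_add_right _ _

/-- On a run along which the algorithm respects zeros, the iterate `t` is supported on as many
initial coordinates as there were successes. -/
theorem support_iterate_lt {b l q : ℝ} {h0 : 0 ≤ q} {h1 : q ≤ 1} (A : FirstOrderAlgorithm.{u} d)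
    (ω : A.RunSpace (chainOracle d b l q h0 h1))
    (hω : ∀ t : ℕ, Function.support (fun i => A.iterate (chainOracle d b l q h0 h1) t ω i) ⊆
      ⋃ s < t, Function.support (fun i => A.answer (chainOracle d b l q h0 h1) s ω i))
    (t : ℕ) : ∀ i, A.iterate (chainOracle d b l q h0 h1) t ω i ≠ 0 →
      i.val < successes ω.2 t := by
  induction t using Nat.strong_induction_on with
  | _ t ih =>
    intro i hi
    have hmem := hω t hi
    simp only [Set.mem_iUnion, Function.mem_support] at hmem
    obtain ⟨s, hs, hne⟩ := hmem
    -- As `s < t`, it suffices to count successes through sample `s`, the one that may have unlocked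
    -- coordinate `i`.
    refine lt_of_lt_of_le ?_ (successes_mono ω.2 (Nat.succ_le_of_lt hs))
    have hx : ∀ j, (l⁻¹ • A.iterate (chainOracle d b l q h0 h1) s ω) j ≠ 0 →
        j.val < successes ω.2 s := fun j hj => ih s hs j fun hc => hj (by simp [hc])
    have hans : (chainGrad (l⁻¹ • A.iterate (chainOracle d b l q h0 h1) s ω)
        + (reveal q (ω.2 s) - 1) •
          frontierGrad (l⁻¹ • A.iterate (chainOracle d b l q h0 h1) s ω)) i ≠ 0 := fun hc => by
      refine hne ?_
      show (b • (chainGrad (l⁻¹ • A.iterate (chainOracle d b l q h0 h1) s ω)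
        + (reveal q (ω.2 s) - 1) •
          frontierGrad (l⁻¹ • A.iterate (chainOracle d b l q h0 h1) s ω))) i = 0
      rw [PiLp.smul_apply, hc, smul_zero]
    rcases lt_of_chainGrad_add_ne_zero hx hans with h | ⟨h, hθ⟩
    · exact h.trans_le (successes_mono ω.2 (Nat.le_succ s))
    · have hz : ω.2 s = true := by
        by_contra hz
        exact hθ (by simp [reveal, hz])
      have hsucc : successes ω.2 (s + 1) = successes ω.2 s + 1 :=
        (successes_succ ω.2 s).trans (congrArg (successes ω.2 s + ·) (if_pos hz))
      exact (Nat.lt_succ_of_le h.le).trans_eq hsucc.symm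

theorem measurable_successes (t : ℕ) : Measurable fun z : ℕ → Bool => successes z t := by
  refine Finset.measurable_fun_sum _ fun s _ => ?_
  exact (measurable_of_finite fun c : Bool => if c then 1 else 0).comp (measurable_pi_apply s)

theorem lintegral_successes {q : ℝ} (h0 : 0 ≤ q) (h1 : q ≤ 1) (t : ℕ) :
    ∫⁻ z, (successes z t : ENNReal) ∂Measure.infinitePi (fun _ : ℕ => coin q)
      = t * ENNReal.ofReal q := by
  have := isProbabilityMeasure_coin h0 h1
  have hm : Measurable fun c : Bool => if c then (1 : ENNReal) else 0 := measurable_of_finite _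
  simp only [successes, Nat.cast_sum, Nat.cast_ite, Nat.cast_one, Nat.cast_zero]
  rw [lintegral_finsetSum (f := fun s (z : ℕ → Bool) => if z s then (1 : ENNReal) else 0) _
    fun s _ => hm.comp (measurable_pi_apply s)]
  have hone : ∀ s : ℕ, ∫⁻ z : ℕ → Bool, (if z s then (1 : ENNReal) else 0)
      ∂Measure.infinitePi (fun _ : ℕ => coin q) = ENNReal.ofReal q := fun s => by
    rw [(measurePreserving_eval_infinitePi (fun _ : ℕ => coin q) s).lintegral_comp hm]
    simp [coin]
  simp [hone]

/-- While `2 * t * q ≤ d`, at least half of the runs leave the last coordinate untouched. -/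
theorem half_le_measure_successes_lt {q : ℝ} (h0 : 0 ≤ q) (h1 : q ≤ 1) {t : ℕ} (hd : 0 < d)
    (ht : 2 * (t * q) ≤ d) :
    1 / 2 ≤ Measure.infinitePi (fun _ : ℕ => coin q) {z | successes z t < d} := by
  have := isProbabilityMeasure_coin h0 h1
  set μ := Measure.infinitePi (fun _ : ℕ => coin q)
  have hS : MeasurableSet {z : ℕ → Bool | successes z t < d} :=
    measurable_successes t measurableSet_Iio
  -- Markov's inequality: the expected number of successes is `t * q`, at most `d / 2`.
  have hmarkov : (d : ENNReal) * μ {z | successes z t < d}ᶜ ≤ d * (1 / 2) := by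
    have h := mul_meas_ge_le_lintegral (μ := μ)
      ((measurable_of_countable (fun n : ℕ => (n : ENNReal))).comp (measurable_successes t))
      (d : ENNReal)
    have hset : {z : ℕ → Bool | successes z t < d}ᶜ
        = {z | (d : ENNReal) ≤ ((fun n : ℕ => (n : ENNReal)) ∘ fun z => successes z t) z} := by
      ext z; simp
    rw [hset]
    refine h.trans ?_
    show ∫⁻ z, (successes z t : ENNReal) ∂μ ≤ _
    rw [lintegral_successes h0 h1, ← ENNReal.ofReal_natCast, ← ENNReal.ofReal_natCast d,
      ← ENNReal.ofReal_mul (by positivity),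
      show (1 / 2 : ENNReal) = ENNReal.ofReal (1 / 2) by
        rw [ENNReal.ofReal_div_of_pos (by norm_num)]; simp,
      ← ENNReal.ofReal_mul (by positivity)]
    exact ENNReal.ofReal_le_ofReal (by linarith)
  have hc : μ {z | successes z t < d}ᶜ ≤ 1 / 2 :=
    (ENNReal.mul_le_mul_iff_right (by exact_mod_cast hd.ne') (by simp)).1 hmarkov
  have hadd := prob_add_prob_compl (μ := μ) hS
  by_contra! hlt
  have : μ {z | successes z t < d} + μ {z | successes z t < d}ᶜ < 1 / 2 + 1 / 2 :=
    ENNReal.add_lt_add_of_lt_of_le (ne_top_of_le_ne_top (by simp) hc) hlt hc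
  rw [hadd, ENNReal.add_halves] at this
  exact lt_irrefl _ this

theorem expectedGradNorm_chainOracle_ge {a l q : ℝ} (h0 : 0 ≤ q) (h1 : q ≤ 1) (ha : 0 ≤ a)
    (hl : 0 < l) (A : FirstOrderAlgorithm.{u} d)
    (hA : A.IsZeroRespecting (chainOracle d (a / l) l q h0 h1)) {t : ℕ} (hd : 0 < d)
    (ht : 2 * (t * q) ≤ d) :
    ENNReal.ofReal (a / l / 8) * (1 / 2)
      ≤ A.expectedGradNorm (chainOracle d (a / l) l q h0 h1) (scaledChain d a l) t := by
  have := isProbabilityMeasure_coin h0 h1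
  set O := chainOracle d (a / l) l q h0 h1 with hO
  set μ : Measure (ℕ → Bool) := Measure.infinitePi (fun _ : ℕ => coin q) with hμ
  have hrun : A.runLaw O = A.seedLaw.prod μ := rfl
  have hS : MeasurableSet {z : ℕ → Bool | successes z t < d} :=
    measurable_successes t measurableSet_Iio
  set E : Set (A.Seed × (ℕ → Bool)) := Prod.snd ⁻¹' {z | successes z t < d} with hE
  have hEm : MeasurableSet E := measurable_snd hS
  have hEμ : (1 / 2 : ENNReal) ≤ A.seedLaw.prod μ E := by
    rw [measurePreserving_snd.measure_preimage hS.nullMeasurableSet]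
    exact half_le_measure_successes_lt h0 h1 hd ht
  calc ENNReal.ofReal (a / l / 8) * (1 / 2)
      ≤ ENNReal.ofReal (a / l / 8) * A.seedLaw.prod μ E := by gcongr
    _ = ∫⁻ ω, E.indicator (fun _ => ENNReal.ofReal (a / l / 8)) ω ∂A.seedLaw.prod μ := by
        rw [lintegral_indicator_const hEm]
    _ ≤ ∫⁻ ω, ‖gradient (scaledChain d a l) (A.iterate O t ω)‖ₑ ∂A.runLaw O := by
        rw [hrun]
        refine lintegral_mono_ae ?_
        filter_upwards [hA] with ω hω
        by_cases hmem : ω ∈ E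
        · rw [Set.indicator_of_mem hmem, ← ofReal_norm, gradient_scaledChain, norm_smul,
            Real.norm_of_nonneg (by positivity)]
          refine ENNReal.ofReal_le_ofReal ?_
          have hlast : A.iterate O t ω ⟨d - 1, by omega⟩ = 0 := by
            by_contra hne
            have h2 := support_iterate_lt A ω hω t _ hne
            have h3 : successes ω.2 t < d := hmem
            simp only at h2
            omega
          have := norm_chainGrad_ge (l⁻¹ • A.iterate O t ω) ⟨d - 1, by omega⟩ (by simp [hlast])
          rw [div_eq_mul_one_div (a / l)]
          gcongr
        · rw [Set.indicator_of_notMem hmem]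
          exact zero_le

end HardChain

/-! ### Choice of parameters and the final rate -/

open HardChain

theorem mainTheorem3 (p : ℝ) (hp1 : 1 < p) (hp2 : p ≤ 2) :
    ∃ c : ℝ, 0 < c ∧
      ∀ Δ₁ L₀ σ₀ : ℝ, 0 < Δ₁ → 0 < L₀ → 0 < σ₀ →
        ∃ ε₀ : ℝ, 0 < ε₀ ∧ ∀ ε : ℝ, 0 < ε → ε ≤ ε₀ →
          ∃ (d : ℕ) (F : Vec d → ℝ) (O : StochasticOracle d),
            InitialGapAtMost F Δ₁ ∧ IsSmoothFun F L₀ ∧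
            O.IsUnbiased F ∧ O.NoiseMomentAtMost F p σ₀ ∧
            ∀ A : FirstOrderAlgorithm.{u} d, A.IsZeroRespecting O → A.StartsAt O 0 →
              ∀ t : ℕ,
                ((t + 1 : ℕ) : ℝ) ≤
                  c * (Δ₁ * L₀ * σ₀ ^ (p / (p - 1)) * ε ^ (-((3 * p - 2) / (p - 1)))) →
                ENNReal.ofReal ε < A.expectedGradNorm O F t := by
  have hp : 0 < p - 1 := by linarith
  set r : ℝ := p / (p - 1) with hr
  have hr0 : 0 < r := div_pos (by linarith) hp
  refine ⟨1 / (24 * 33792 * 64 ^ r), by positivity, fun Δ₁ L₀ σ₀ hΔ hL hσ => ?_⟩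
  -- The first bound makes `q ≤ 1`; the second makes `Δ₁ / (6 * a) ≥ 1`, so the chain has at least
  -- one link and rounding down loses at most a factor 2.
  refine ⟨min (σ₀ / 64) (Real.sqrt (Δ₁ * L₀ / (6 * 33792))), by positivity, fun ε hε hle => ?_⟩
  have hεσ : 64 * ε / σ₀ ≤ 1 := by
    rw [div_le_one hσ]
    linarith [hle.trans (min_le_left _ _)]
  have hεΔ : ε ^ 2 ≤ Δ₁ * L₀ / (6 * 33792) :=
    (Real.le_sqrt hε.le (by positivity)).1 (hle.trans (min_le_right _ _))
  -- The constants solve `a / l = 32 * ε` and `33 * a = L₀ * l ^ 2`. The gradient is then at least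
  -- `32 * ε / 8 = 4 * ε` on half of the runs, giving mean at least `2 * ε`.
  set l : ℝ := 1056 * ε / L₀ with hl_def
  set a : ℝ := 33792 * ε ^ 2 / L₀ with ha_def
  -- Makes `q ^ (1 - p) = (64 * ε / σ₀) ^ (-p)`; the ratio 64 / 32 supplies a `2 ^ p ≥ 2` that
  -- absorbs the factor 2 in the noise bound.
  set q : ℝ := (64 * ε / σ₀) ^ r with hq_def
  have hl : 0 < l := by positivity
  have ha : 0 < a := by positivity
  have hq0 : 0 < q := by positivity
  have hq1 : q ≤ 1 := Real.rpow_le_one (by positivity) hεσ hr0.le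
  have hal : a / l = 32 * ε := by
    rw [ha_def, hl_def]; field_simp; norm_num
  have hone : 1 ≤ Δ₁ / (6 * a) := by
    rw [le_div_iff₀ (by positivity)] at hεΔ
    rw [le_div_iff₀ (by positivity), ha_def, one_mul, ← mul_div_assoc, div_le_iff₀ hL]
    linarith
  set d : ℕ := ⌊Δ₁ / (6 * a)⌋₊ with hd_def
  have hd0 : 0 < d := Nat.floor_pos.2 hone
  have hdle : (d : ℝ) ≤ Δ₁ / (6 * a) := Nat.floor_le (by positivity)
  have hdge : Δ₁ / (12 * a) ≤ d := by
    have h1 := Nat.lt_floor_add_one (Δ₁ / (6 * a))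
    have h2 : (1 : ℝ) ≤ d := by exact_mod_cast hd0
    have h3 : Δ₁ / (12 * a) = Δ₁ / (6 * a) / 2 := by field_simp; norm_num
    rw [← hd_def] at h1
    linarith
  refine ⟨d, scaledChain d a l, chainOracle d (a / l) l q hq0.le hq1,
    initialGapAtMost_scaledChain ha.le ?_, isSmoothFun_scaledChain ha.le hl ?_,
    isUnbiased_chainOracle hq0 hq1,
    noiseMomentAtMost_chainOracle hq0 hq1 hp1 ha.le hl ?_, fun A hA _ t ht => ?_⟩
  · rw [le_div_iff₀ (by positivity)] at hdle
    linarith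
  · rw [ha_def, hl_def]
    apply le_of_eq
    field_simp
    norm_num
  · have h1 : q ^ (1 - p) = ((64 * ε / σ₀) ^ p)⁻¹ := by
      rw [hq_def, ← Real.rpow_mul (by positivity), ← Real.rpow_neg (by positivity)]
      congr 1
      rw [hr]
      field_simp
      ring
    have h2 : (64 * ε / σ₀) ^ p = 2 ^ p * (32 * ε) ^ p / σ₀ ^ p := by
      rw [← Real.mul_rpow (by norm_num) (by positivity), ← Real.div_rpow (by positivity) hσ.le]
      ring_nf
    have h3 : (2 : ℝ) ≤ 2 ^ p := by
      simpa using Real.rpow_le_rpow_of_exponent_le (by norm_num : (1 : ℝ) ≤ 2) hp1.le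
    have h4 : 0 < (32 * ε) ^ p := by positivity
    have h5 : 0 < σ₀ ^ p := by positivity
    rw [h1, hal, h2, inv_div, mul_div_assoc', div_le_iff₀ (by positivity)]
    nlinarith [mul_pos h4 h5]
  · have ht' : 2 * (t * q) ≤ (d : ℝ) := by
      have hexp : ε ^ (-((3 * p - 2) / (p - 1))) = (ε ^ 2)⁻¹ * (ε ^ r)⁻¹ := by
        rw [← Real.rpow_natCast ε 2, ← Real.rpow_neg hε.le, ← Real.rpow_neg hε.le,
          ← Real.rpow_add hε]
        congr 1
        rw [hr]
        field_simp
        push_cast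
        ring
      have hq_eq : q = 64 ^ r * ε ^ r / σ₀ ^ r := by
        rw [hq_def, Real.div_rpow (by positivity) hσ.le, Real.mul_rpow (by norm_num) hε.le]
      have hbound : (t : ℝ) ≤ Δ₁ / (24 * a * q) := by
        -- The iterate numbered `t` has seen only `t` samples, so the extra 1 can be dropped.
        calc (t : ℝ) ≤ ((t + 1 : ℕ) : ℝ) := by push_cast; linarith
          _ ≤ _ := ht
          _ = Δ₁ / (24 * a * q) := by
            have h64 : (64 : ℝ) ^ r ≠ 0 := by positivity
            have he : ε ^ r ≠ 0 := by positivity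
            have hs : σ₀ ^ r ≠ 0 := by positivity
            rw [hexp, hq_eq, ha_def]
            field_simp
      rw [le_div_iff₀ (by positivity)] at hbound
      rw [div_le_iff₀ (by positivity)] at hdge
      nlinarith
    refine lt_of_lt_of_le ?_ (expectedGradNorm_chainOracle_ge hq0.le hq1 ha.le hl A hA hd0 ht')
    rw [show (1 / 2 : ENNReal) = ENNReal.ofReal (1 / 2) by
        rw [ENNReal.ofReal_div_of_pos (by norm_num)]; simp,
      ← ENNReal.ofReal_mul (by positivity), hal]
    exact (ENNReal.ofReal_lt_ofReal_iff (by positivity)).2 (by linarith)
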